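/- Let $\widehat{\mathfrak g}$ be a finite-dimensional real Lie algebra. For a basis $X_1,\dots,X_m$ of a Lie algebra $\mathfrak h$ with $[X_i,X_j]=\sum_k C_{ij}^kX_k$, let $x_1,\dots,x_m$ be the corresponding linear coordinates on $\mathfrak h^*$ ($x_i(f)=f(X_i)$), and put $\mathcal N(\mathfrak h)=\dim\mathfrak h-\operatorname{rank}\bigl(\sum_k C_{ij}^kx_k\bigr)_{i,j}$, where the rank is the generic one, i.e. the maximum over $x$. An invariant of $\mathfrak h$ on a set $U\subseteq\mathfrak h^*$ is a real-valued function $F$ that is analytic on $U$ and constant along the coadjoint action: $F(\mathrm{Ad}^*_{\exp X}f)=F(f)$ for all $X\in\mathfrak h$ and $f\in U$ such that $\mathrm{Ad}^*_{\exp tX}f\in U$ for all $t\in[0,1]$. (For $U=\mathfrak h^*$ this is invariance under the connected Lie group of $\mathfrak h$.) Let $\mathfrak g$ be a subalgebra of codimension $1$ of $\widehat{\mathfrak g}$ with $\mathcal N(\widehat{\mathfrak g})=\mathcal N(\mathfrak g)-1$. Then every invariant of $\widehat{\mathfrak g}$ depends only on the generators of $\mathfrak g$, and is also an invariant of $\mathfrak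 g$. Precisely, let $r:\widehat{\mathfrak g}^*\to\mathfrak g^*$ be the restriction of linear forms, let $U\subseteq\widehat{\mathfrak g}^*$ be open, and let $F$ be an invariant of $\widehat{\mathfrak g}$ on $U$. Then every point of $U$ has an open neighbourhood $V\subseteq U$ for which there is an invariant $\Phi$ of $\mathfrak g$ on $r(V)$ with $F=\Phi\circ r$ on $V$; and if each set $U\cap r^{-1}(y)$, $y\in\mathfrak g^*$, is connected or empty (for instance if $U=\widehat{\mathfrak g}^*$), then one may take $V=U$. In particular, there is an element $X\in\widehat{\mathfrak g}\setminus\mathfrak g$ such that, in the coordinates on $\widehat{\mathfrak g}^*$ given by any basis of $\widehat{\mathfrak g}$ that consists of a basis of $\mathfrak g$ and $X$, with $x$ the coordinate of $X$, $$\frac{\partial F}{\partial x}=0\quad\text{on }U$$ for every open $U\subseteq\widehat{\mathfrak g}^*$ and every invariant $F$ of $\widehat{\mathfrak g}$ on $U$. -/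

import Mathlib

open Module

noncomputable section

/-- The structure constants `C_{ij}^k` of a Lie algebra in the basis `X_i = b i`:
`⁅X_i, X_j⁆ = ∑ k, C_{ij}^k X_k`. -/
def structureConstant {ι L : Type*} [LieRing L] [LieAlgebra ℝ L]
    (b : Basis ι ℝ L) (i j k : ι) : ℝ :=
  b.repr ⁅b i, b j⁆ k

/-- The matrix `(C_{ij}^k x_k)`, evaluated at the point of the dual space with coordinates `x`.
A linear form `f` on `L` has the coordinates `x k = f (b k)`. -/
def commutatorMatrix {ι L : Type*} [Fintype ι] [LieRing L] [LieAlgebra ℝ L]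
    (b : Basis ι ℝ L) (x : ι → ℝ) : Matrix ι ι ℝ :=
  Matrix.of fun i j => ∑ k, structureConstant b i j k * x k

/-- The rank of the matrix of linear functions `(C_{ij}^k x_k)`, that is, its generic rank: the
largest rank attained at a point `x`. -/
def genericRank {ι L : Type*} [Fintype ι] [LieRing L] [LieAlgebra ℝ L]
    (b : Basis ι ℝ L) : ℕ :=
  ⨆ x : ι → ℝ, (commutatorMatrix b x).rank

/-- `𝒩(L) = dim L - rank (C_{ij}^k x_k)`. The rank does not depend on the basis and is at most
`dim L`, so the subtraction of natural numbers is not truncated. -/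
def invariantNumber (L : Type*) [LieRing L] [LieAlgebra ℝ L] [FiniteDimensional ℝ L] : ℕ :=
  finrank ℝ L - genericRank (Module.finBasis ℝ L)

/-- The coadjoint action of the group element `exp X` on the dual space of `L`, in coordinates:
`f ↦ f ∘ exp (-ad X)`. The matrix of `ad X` acts on columns of coordinates of `L`, hence on
coordinates of linear forms (rows) from the right. -/
def coadjointExp {ι L : Type*} [Fintype ι] [DecidableEq ι] [LieRing L] [LieAlgebra ℝ L]
    (b : Basis ι ℝ L) (X : L) (x : ι → ℝ) : ι → ℝ :=
  Matrix.vecMul x (NormedSpace.exp (-(LinearMap.toMatrix b b (LieAlgebra.ad ℝ L X))))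

/-- `F` is an invariant of the coadjoint representation, defined on the set `U` of points of the
dual space (in the coordinates given by `b`): it is analytic there, and it takes the same value at
`f` and at `Ad*(exp X) f` whenever the arc `Ad*(exp (t X)) f`, `0 ≤ t ≤ 1`, stays in `U`.
For `U = univ` this is invariance under the whole connected Lie group of `L`, because the elements
`exp X` generate that group; a proper subset `U` is needed for rational, algebraic or logarithmic
invariants. -/
def IsCoadjointInvariantOn {ι L : Type*} [Fintype ι] [DecidableEq ι] [LieRing L] [LieAlgebra ℝ L]
    (b : Basis ι ℝ L) (U : Set (ι → ℝ)) (F : (ι → ℝ) → ℝ) : Prop :=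
  AnalyticOnNhd ℝ F U ∧
    ∀ X : L, ∀ x ∈ U, (∀ t ∈ Set.Icc (0 : ℝ) 1, coadjointExp b (t • X) x ∈ U) →
      F (coadjointExp b X x) = F x

/-- The partial derivative `∂F/∂x_i` at the point `x`. -/
def partialDeriv {ι : Type*} [Fintype ι] [DecidableEq ι]
    (F : (ι → ℝ) → ℝ) (i : ι) (x : ι → ℝ) : ℝ :=
  fderiv ℝ F x (Pi.single i 1)

/-- Let `c` be a basis of the subalgebra `g`, and suppose that the first `n` of the coordinates
`x_0, …, x_n` are those of `g`. On the set `V`, the function `F` is a function of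
`x_0, …, x_{n-1}` only, and as such a function it is an invariant of `g` on the image of `V`
under restriction of linear forms to `g` (which forgets the last coordinate). -/
def IsInvariantOfSubalgebraOn {n : ℕ} {L : Type*} [LieRing L] [LieAlgebra ℝ L]
    {g : LieSubalgebra ℝ L} (c : Basis (Fin n) ℝ g)
    (V : Set (Fin (n + 1) → ℝ)) (F : (Fin (n + 1) → ℝ) → ℝ) : Prop :=
  ∃ Φ : (Fin n → ℝ) → ℝ,
    (∀ x ∈ V, F x = Φ (fun i => x i.castSucc)) ∧
    IsCoadjointInvariantOn c ((fun (x : Fin (n + 1) → ℝ) (i : Fin n) => x i.castSucc) '' V) Φ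

end

/-! Let B_f(X, Y) = f([X, Y]). The hypothesis on 𝒩 says that the generic rank of B_f on L exceeds
the one on g by two. If f has more than the generic rank of g, ker B_f lies in g: a kernel vector
outside g would span L together with g, and B_f would have the rank of its restriction to g
(`mem_of_commutatorForm_eq_zero`). Such f accumulate at every point
(`exists_line_finrank_range_lt`).

The differential of an invariant F at f, read as an element of L, kills the tangent directions of
the orbit and so lies in ker B_f. Hence ∂F/∂x vanishes at these f, and everywhere by continuity. So
F is constant on connected fibres of the restriction r and descends to g*; the descended function is
invariant because r intertwines the coadjoint fields of elements of g. -/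

/-! ### The commutator matrix as a bilinear form -/

/-- The linear map `X ↦ f ∘ ad X` from a Lie algebra to its dual, attached to a linear form `f`. -/
noncomputable def commutatorForm {L : Type*} [LieRing L] [LieAlgebra ℝ L] (f : Dual ℝ L) : L →ₗ[ℝ] Dual ℝ L :=
  ((LieAlgebra.ad ℝ L : L →ₗ[ℝ] End ℝ L)).compr₂ f

@[simp]
lemma commutatorForm_apply {L : Type*} [LieRing L] [LieAlgebra ℝ L] (f : Dual ℝ L) (X Y : L) :
    commutatorForm f X Y = f ⁅X, Y⁆ := rfl

section Rank

variable {ι L : Type*} [Fintype ι] [LieRing L] [LieAlgebra ℝ L]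

lemma commutatorMatrix_apply (b : Basis ι ℝ L) (x : ι → ℝ) (i j : ι) :
    commutatorMatrix b x i j = b.constr ℝ x ⁅b i, b j⁆ := by
  simp [commutatorMatrix, structureConstant, Basis.constr_apply_fintype]

lemma rank_commutatorMatrix [DecidableEq ι] (b : Basis ι ℝ L) (x : ι → ℝ) :
    (commutatorMatrix b x).rank =
      finrank ℝ (LinearMap.range (commutatorForm (b.constr ℝ x))) := by
  have h : Matrix.toLin b b.dualBasis (commutatorMatrix b x).transpose =
      commutatorForm (b.constr ℝ x) := by
    refine b.ext fun i => b.ext fun j => ?_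
    simp [Matrix.toLin_self, commutatorMatrix_apply, Finsupp.single_apply]
  rw [← Matrix.rank_transpose, Matrix.rank_eq_finrank_range_toLin _ b.dualBasis b, h]

lemma genericRank_eq_iSup [DecidableEq ι] (b : Basis ι ℝ L) :
    genericRank b =
      ⨆ f : Dual ℝ L, finrank ℝ (LinearMap.range (commutatorForm f)) := by
  rw [genericRank, ← (b.constr ℝ (M' := ℝ)).toEquiv.iSup_comp]
  exact iSup_congr fun x => rank_commutatorMatrix b x

variable [FiniteDimensional ℝ L]

lemma bddAbove_range_finrank_commutatorForm :
    BddAbove (Set.range fun f : Dual ℝ L => finrank ℝ (LinearMap.range (commutatorForm f))) := by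
  refine ⟨finrank ℝ L, ?_⟩
  rintro _ ⟨f, rfl⟩
  exact LinearMap.finrank_range_le _

lemma finrank_range_commutatorForm_le (b : Basis ι ℝ L) (f : Dual ℝ L) :
    finrank ℝ (LinearMap.range (commutatorForm f)) ≤ genericRank b := by
  classical
  rw [genericRank_eq_iSup]
  exact le_ciSup bddAbove_range_finrank_commutatorForm f

lemma exists_finrank_range_commutatorForm_eq (b : Basis ι ℝ L) :
    ∃ f : Dual ℝ L, finrank ℝ (LinearMap.range (commutatorForm f)) = genericRank b := by
  classical
  rw [genericRank_eq_iSup]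
  exact Nat.sSup_mem (Set.range_nonempty _) bddAbove_range_finrank_commutatorForm

lemma genericRank_le_finrank (b : Basis ι ℝ L) : genericRank b ≤ finrank ℝ L := by
  obtain ⟨f, hf⟩ := exists_finrank_range_commutatorForm_eq b
  exact hf ▸ LinearMap.finrank_range_le _

end Rank

/-- If the commutator form of `f` has larger rank than that of its restriction to a subalgebra of
codimension one, then its kernel is contained in the subalgebra. -/
lemma mem_of_commutatorForm_eq_zero {L : Type*} [LieRing L] [LieAlgebra ℝ L]
    [FiniteDimensional ℝ L] {g : LieSubalgebra ℝ L} (hcodim : finrank ℝ L = finrank ℝ g + 1)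
    {f : Dual ℝ L}
    (hf : finrank ℝ (LinearMap.range (commutatorForm (f.comp g.toSubmodule.subtype : Dual ℝ g))) <
      finrank ℝ (LinearMap.range (commutatorForm f)))
    {Z : L} (hZ : commutatorForm f Z = 0) : Z ∈ g := by
  by_contra hZg
  have htop : g.toSubmodule ⊔ Submodule.span ℝ {Z} = ⊤ := by
    apply Submodule.eq_top_of_finrank_eq
    have hlt : finrank ℝ g.toSubmodule <
        finrank ℝ (g.toSubmodule ⊔ Submodule.span ℝ {Z} : Submodule ℝ L) := by
      apply Submodule.finrank_lt_finrank_of_lt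
      refine lt_of_le_of_ne le_sup_left fun h => hZg ?_
      change Z ∈ g.toSubmodule
      rw [h]
      exact Submodule.mem_sup_right (Submodule.mem_span_singleton_self Z)
    have hle := Submodule.finrank_le (g.toSubmodule ⊔ Submodule.span ℝ {Z} : Submodule ℝ L)
    have : finrank ℝ g.toSubmodule = finrank ℝ g := rfl
    omega
  have hrange : LinearMap.range (commutatorForm f) = g.toSubmodule.map (commutatorForm f) := by
    rw [LinearMap.range_eq_map, ← htop, Submodule.map_sup, Submodule.map_span]
    simp [hZ]
  let res : Dual ℝ L →ₗ[ℝ] Dual ℝ g := g.toSubmodule.subtype.dualMap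
  -- A form B_f(Y, ·) vanishing on g also vanishes at Z by skew symmetry, hence on L. Restriction to
  -- g is thus injective on the range, and the two ranks agree.
  have hdisj : Disjoint (g.toSubmodule.map (commutatorForm f)) (LinearMap.ker res) := by
    rw [Submodule.disjoint_def]
    rintro _ ⟨Y, -, rfl⟩ hY
    have hker : g.toSubmodule ⊔ Submodule.span ℝ {Z} ≤ LinearMap.ker (commutatorForm f Y) := by
      refine sup_le (fun W hW => ?_) ?_
      · exact LinearMap.congr_fun (LinearMap.mem_ker.1 hY) ⟨W, hW⟩
      · rw [Submodule.span_singleton_le_iff_mem, LinearMap.mem_ker, commutatorForm_apply,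
          ← lie_skew, map_neg, ← commutatorForm_apply, hZ]
        simp
    ext W
    exact hker (htop ▸ Submodule.mem_top)
  have hmap : (g.toSubmodule.map (commutatorForm f)).map res =
      LinearMap.range (commutatorForm (f.comp g.toSubmodule.subtype : Dual ℝ g)) := by
    apply le_antisymm
    · rintro _ ⟨_, ⟨Y, hY, rfl⟩, rfl⟩
      exact ⟨⟨Y, hY⟩, rfl⟩
    · rintro _ ⟨Y, rfl⟩
      exact ⟨_, ⟨Y, Y.2, rfl⟩, rfl⟩
  have hinj : Function.Injective (res.domRestrict (g.toSubmodule.map (commutatorForm f))) :=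
    LinearMap.injective_domRestrict_iff.2 hdisj
  have hfin := LinearMap.finrank_range_of_inj hinj
  rw [LinearMap.range_domRestrict, hmap, ← hrange] at hfin
  omega

/-- Rank can only increase generically along a line: it is at least its value at `1` for all but
finitely many parameters. -/
lemma eventually_finrank_range_ge {V W : Type*} [AddCommGroup V] [Module ℝ V]
    [AddCommGroup W] [Module ℝ W] [FiniteDimensional ℝ W] (A D : V →ₗ[ℝ] W) :
    ∀ᶠ t : ℝ in nhdsWithin 0 {0}ᶜ,
      finrank ℝ (LinearMap.range (A + D)) ≤ finrank ℝ (LinearMap.range (A + t • D)) := by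
  classical
  set T := A + D with hT
  let w := finBasis ℝ (LinearMap.range T)
  choose v hv using fun i => (w i).2
  obtain ⟨π, hπ⟩ := LinearMap.exists_leftInverse_of_injective (LinearMap.range T).subtype
    (Submodule.ker_subtype _)
  let φ : W →ₗ[ℝ] (Fin (finrank ℝ (LinearMap.range T)) → ℝ) := w.equivFun.toLinearMap.comp π
  have hφ : ∀ i, φ (T (v i)) = Pi.single i 1 := by
    intro i
    have : π (w i : W) = w i := LinearMap.congr_fun hπ (w i)
    ext j
    simp [φ, hv, this, Pi.single_apply, eq_comm]
  -- P + tQ represents A + tD on the vectors v i. Its determinant is a polynomial in t equal to 1 at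
  -- t = 1, so it has finitely many roots.
  let P : Matrix _ _ ℝ := Matrix.of fun i => φ (A (v i))
  let Q : Matrix _ _ ℝ := Matrix.of fun i => φ (D (v i))
  let p : Polynomial ℝ :=
    (P.map Polynomial.C + (Polynomial.X : Polynomial ℝ) • Q.map Polynomial.C).det
  have hp : ∀ t, p.eval t = (P + t • Q).det := by
    intro t
    rw [← Polynomial.coe_evalRingHom, RingHom.map_det]
    congr 1
    ext i j
    simp only [RingHom.mapMatrix_apply, Matrix.map_apply, Matrix.add_apply, Matrix.smul_apply,
      smul_eq_mul, Polynomial.coe_evalRingHom, Polynomial.eval_add, Polynomial.eval_mul,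
      Polynomial.eval_X, Polynomial.eval_C]
  have hp1 : p.eval 1 = 1 := by
    have : P + (1 : ℝ) • Q = 1 := by
      ext i j
      have := congrFun (hφ i) j
      simpa [P, Q, hT, Matrix.one_apply, Pi.single_apply, eq_comm] using this
    rw [hp, this, Matrix.det_one]
  have hp0 : p ≠ 0 := by
    rintro h
    simp [h] at hp1
  have hev : ∀ᶠ t : ℝ in nhdsWithin 0 {0}ᶜ, p.eval t ≠ 0 := by
    have hfin : (p.roots.toFinset : Set ℝ).Finite := Finset.finite_toSet _
    have hmem : ((p.roots.toFinset : Set ℝ) \ {0})ᶜ ∈ nhds (0 : ℝ) :=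
      (hfin.subset Set.sdiff_subset).isClosed.isOpen_compl.mem_nhds (by simp)
    filter_upwards [nhdsWithin_le_nhds hmem, self_mem_nhdsWithin] with t ht ht0 hroot
    exact ht ⟨by simpa [hp0] using hroot, ht0⟩
  filter_upwards [hev] with t ht
  rw [hp] at ht
  have hli : LinearIndependent ℝ (P + t • Q).row :=
    Matrix.linearIndependent_rows_of_det_ne_zero ht
  have hrow : (P + t • Q).row = φ ∘ fun i => (A + t • D) (v i) := by
    ext i j
    simp [P, Q, Matrix.row]
  rw [hrow] at hli
  have hli' : LinearIndependent ℝ fun i =>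
      (⟨(A + t • D) (v i), v i, rfl⟩ : LinearMap.range (A + t • D)) :=
    LinearIndependent.of_comp (LinearMap.range (A + t • D)).subtype hli.of_comp
  simpa using hli'.fintype_card_le_finrank

/-! ### Infinitesimal invariance -/

section Coadjoint

variable {ι L : Type*} [Fintype ι] [DecidableEq ι] [LieRing L] [LieAlgebra ℝ L]

/-- The vector field on the dual space generated by `X` under the coadjoint action. -/
noncomputable def coadjointField (b : Basis ι ℝ L) (X : L) (x : ι → ℝ) : ι → ℝ :=
  Matrix.vecMul x (-(LinearMap.toMatrix b b (LieAlgebra.ad ℝ L X)))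

lemma coadjointField_apply (b : Basis ι ℝ L) (X : L) (x : ι → ℝ) (j : ι) :
    coadjointField b X x j = -b.constr ℝ x ⁅X, b j⁆ := by
  simp [coadjointField, Matrix.vecMul, dotProduct, LinearMap.toMatrix_apply,
    Basis.constr_apply_fintype, mul_comm]

lemma coadjointExp_zero_smul (b : Basis ι ℝ L) (X : L) (x : ι → ℝ) :
    coadjointExp b ((0 : ℝ) • X) x = x := by
  simp [coadjointExp, NormedSpace.exp_zero]

open scoped Matrix.Norms.Operator in
lemma hasDerivAt_coadjointExp (b : Basis ι ℝ L) (X : L) (x : ι → ℝ) (t : ℝ) :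
    HasDerivAt (fun s : ℝ => coadjointExp b (s • X) x)
      (coadjointField b X (coadjointExp b (t • X) x)) t := by
  set A := -(LinearMap.toMatrix b b (LieAlgebra.ad ℝ L X)) with hA
  have hexp : ∀ s : ℝ, coadjointExp b (s • X) x = Matrix.vecMul x (NormedSpace.exp (s • A)) := by
    intro s
    simp [coadjointExp, hA]
  have h := hasDerivAt_exp_smul_const A t
  let l : Matrix ι ι ℝ →L[ℝ] (ι → ℝ) :=
    LinearMap.toContinuousLinearMap (Matrix.vecMulBilin ℝ ℝ x)
  have hl := l.hasFDerivAt.comp_hasDerivAt t h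
  simp only [hexp, coadjointField, ← hA, Matrix.vecMul_vecMul]
  exact hl

lemma IsCoadjointInvariantOn.fderiv_coadjointField {b : Basis ι ℝ L} {U : Set (ι → ℝ)}
    {F : (ι → ℝ) → ℝ} (hF : IsCoadjointInvariantOn b U F) (hU : IsOpen U) {x : ι → ℝ}
    (hx : x ∈ U) (X : L) : fderiv ℝ F x (coadjointField b X x) = 0 := by
  have hd := hasDerivAt_coadjointExp b X x 0
  have hFd : HasFDerivAt F (fderiv ℝ F x) (coadjointExp b ((0 : ℝ) • X) x) := by
    rw [coadjointExp_zero_smul]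
    exact (hF.1 x hx).differentiableAt.hasFDerivAt
  have hcomp := hFd.comp_hasDerivAt 0 hd
  rw [coadjointExp_zero_smul] at hcomp
  refine hcomp.unique ((hasDerivAt_const (0 : ℝ) (F x)).congr_of_eventuallyEq ?_)
  have hev : ∀ᶠ s : ℝ in nhds 0, coadjointExp b (s • X) x ∈ U :=
    hd.continuousAt.eventually_mem (hU.mem_nhds (by rwa [coadjointExp_zero_smul]))
  -- A ball around 0 contains ts for all t in [0, 1], so the whole arc stays in U.
  obtain ⟨ε, hε, hball⟩ := Metric.eventually_nhds_iff.1 hev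
  filter_upwards [Metric.ball_mem_nhds (0 : ℝ) hε] with s hs
  refine hF.2 (s • X) x hx fun t ht => ?_
  rw [smul_smul]
  apply hball
  rw [Metric.mem_ball, dist_zero_right, Real.norm_eq_abs] at hs
  rw [dist_zero_right, Real.norm_eq_abs, abs_mul, abs_of_nonneg ht.1]
  exact (mul_le_of_le_one_left (abs_nonneg s) ht.2).trans_lt hs

lemma eq_of_hasDerivAt_zero {S : Set ℝ} (hS : Convex ℝ S) {h : ℝ → ℝ}
    (hd : ∀ s ∈ S, HasDerivAt h 0 s) {s t : ℝ} (hs : s ∈ S) (ht : t ∈ S) : h s = h t := by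
  have := hS.norm_image_sub_le_of_norm_hasDerivWithin_le (C := 0)
    (fun x hx => (hd x hx).hasDerivWithinAt) (by simp) ht hs
  simpa [sub_eq_zero] using this

/-- Infinitesimal invariance implies invariance along arcs. -/
lemma isCoadjointInvariantOn_of_fderiv {b : Basis ι ℝ L} {U : Set (ι → ℝ)} {F : (ι → ℝ) → ℝ}
    (hF : AnalyticOnNhd ℝ F U)
    (h : ∀ x ∈ U, ∀ X : L, fderiv ℝ F x (coadjointField b X x) = 0) :
    IsCoadjointInvariantOn b U F := by
  refine ⟨hF, fun X x _ harc => ?_⟩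
  have := eq_of_hasDerivAt_zero (convex_Icc (0 : ℝ) 1)
    (h := fun t => F (coadjointExp b (t • X) x)) (fun t ht => ?_)
    (Set.right_mem_Icc.2 zero_le_one) (Set.left_mem_Icc.2 zero_le_one)
  · simpa only [one_smul, coadjointExp_zero_smul] using this
  · rw [← h _ (harc t ht) X]
    exact (hF _ (harc t ht)).differentiableAt.hasFDerivAt.comp_hasDerivAt t
      (hasDerivAt_coadjointExp b X x t)

end Coadjoint

/-! ### Subalgebras of codimension one -/

/-- If `𝒩(L) = 𝒩(g) - 1` for a subalgebra of codimension one, the forms whose commutator form on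
`L` has larger rank than any commutator form on `g` accumulate at every point. -/
lemma exists_line_finrank_range_lt {L : Type*} [LieRing L] [LieAlgebra ℝ L]
    [FiniteDimensional ℝ L] {g : LieSubalgebra ℝ L} (hcodim : finrank ℝ L = finrank ℝ g + 1)
    (hN : (invariantNumber L : ℤ) = (invariantNumber g : ℤ) - 1) (f : Dual ℝ L) :
    ∃ e : Dual ℝ L, ∀ᶠ t : ℝ in nhdsWithin 0 {0}ᶜ, ∀ Z : L,
      commutatorForm (f + t • e) Z = 0 → Z ∈ g := by
  obtain ⟨f₀, hf₀⟩ := exists_finrank_range_commutatorForm_eq (finBasis ℝ L)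
  have hL := genericRank_le_finrank (finBasis ℝ L)
  have hg := genericRank_le_finrank (finBasis ℝ g)
  -- The line through f in this direction meets f₀, of maximal rank, at t = 1.
  refine ⟨f₀ - f, ?_⟩
  filter_upwards [eventually_finrank_range_ge (commutatorForm f) (commutatorForm (f₀ - f))]
    with t ht Z hZ
  refine mem_of_commutatorForm_eq_zero hcodim ?_ hZ
  have h₁ : commutatorForm f + commutatorForm (f₀ - f) = commutatorForm f₀ := by
    ext X Y
    simp
  have h₂ : commutatorForm f + t • commutatorForm (f₀ - f) =
      commutatorForm (f + t • (f₀ - f)) := by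
    ext X Y
    simp
  rw [h₁, h₂, hf₀] at ht
  have hle := finrank_range_commutatorForm_le (finBasis ℝ g)
    ((f + t • (f₀ - f)).comp g.toSubmodule.subtype : Dual ℝ g)
  unfold invariantNumber at hN
  omega

/-! ### Coordinates adapted to the subalgebra -/

section LastCoordinate

variable {L : Type*} [LieRing L] [LieAlgebra ℝ L] {n : ℕ}

/-- Identifies the covector l with an element of L by biduality; skew symmetry moves that element
into the first slot of the form. -/
lemma commutatorForm_eq_zero_of_fderiv {ι : Type*} [Fintype ι] [DecidableEq ι] (b : Basis ι ℝ L)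
    (x : ι → ℝ) (l : (ι → ℝ) →L[ℝ] ℝ) (hl : ∀ X, l (coadjointField b X x) = 0) :
    commutatorForm (b.constr ℝ x) (∑ i, l (Pi.single i 1) • b i) = 0 := by
  ext X
  have hsum : l (coadjointField b X x) =
      ∑ i, coadjointField b X x i * l (Pi.single i 1) := by
    conv_lhs => rw [pi_eq_sum_univ' (coadjointField b X x)]
    simp [map_sum]
  have h := hsum.symm.trans (hl X)
  simp only [coadjointField_apply] at h
  rw [commutatorForm_apply, ← lie_skew, map_neg, lie_sum, map_sum, ← Finset.sum_neg_distrib]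
  simpa [mul_comm] using h

/-- A basis of a subalgebra of codimension one obtained by forgetting the last vector of a basis of
the whole algebra. -/
lemma exists_basis_castSucc {g : LieSubalgebra ℝ L} (hcodim : finrank ℝ L = finrank ℝ g + 1)
    (b : Basis (Fin (n + 1)) ℝ L) (hb : ∀ i : Fin n, b i.castSucc ∈ g) :
    ∃ c : Basis (Fin n) ℝ g, ∀ i, b i.castSucc = (c i : L) := by
  have hli : LinearIndependent ℝ fun i : Fin n => (⟨b i.castSucc, hb i⟩ : g) :=
    LinearIndependent.of_comp g.toSubmodule.subtype
      (b.linearIndependent.comp _ (Fin.castSucc_injective n))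
  have hcard : Fintype.card (Fin n) = finrank ℝ g := by
    have := finrank_eq_card_basis b
    simp only [Fintype.card_fin] at this ⊢
    omega
  -- The basis constructor used for positive n needs a nonempty index type.
  rcases Nat.eq_zero_or_pos n with rfl | hn
  · have : FiniteDimensional ℝ L := Module.Finite.of_basis b
    exact ⟨finBasisOfFinrankEq ℝ g (by simpa using hcard.symm), fun i => i.elim0⟩
  · have : Nonempty (Fin n) := ⟨⟨0, hn⟩⟩
    exact ⟨basisOfLinearIndependentOfCardEqFinrank hli hcard, fun i => by simp⟩

variable {g : LieSubalgebra ℝ L} {c : Basis (Fin n) ℝ g} {b : Basis (Fin (n + 1)) ℝ L}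

lemma repr_last_eq_zero (hbc : ∀ i : Fin n, b i.castSucc = (c i : L)) {Z : L} (hZ : Z ∈ g) :
    b.repr Z (Fin.last n) = 0 := by
  have h : (b.coord (Fin.last n)).comp g.toSubmodule.subtype = 0 := by
    refine c.ext fun i => ?_
    change b.repr (c i : L) (Fin.last n) = 0
    rw [← hbc]
    simp [Fin.castSucc_ne_last]
  exact LinearMap.congr_fun h ⟨Z, hZ⟩

lemma constr_comp_castSucc (hbc : ∀ i : Fin n, b i.castSucc = (c i : L)) (x : Fin (n + 1) → ℝ)
    (Y : g) : c.constr ℝ (fun i => x i.castSucc) Y = b.constr ℝ x (Y : L) := by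
  have h : c.constr ℝ (fun i => x i.castSucc) =
      (b.constr ℝ x).comp g.toSubmodule.subtype := by
    refine c.ext fun i => ?_
    change _ = b.constr ℝ x (c i : L)
    rw [← hbc]
    simp
  exact LinearMap.congr_fun h Y

lemma coadjointField_castSucc (hbc : ∀ i : Fin n, b i.castSucc = (c i : L)) (X : g)
    (x : Fin (n + 1) → ℝ) (i : Fin n) :
    coadjointField b X x i.castSucc = coadjointField c X (fun i => x i.castSucc) i := by
  rw [coadjointField_apply, coadjointField_apply, constr_comp_castSucc hbc, hbc]
  rfl

variable {U : Set (Fin (n + 1) → ℝ)} {F : (Fin (n + 1) → ℝ) → ℝ}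

theorem IsCoadjointInvariantOn.partialDeriv_last_eq_zero [FiniteDimensional ℝ L]
    (hcodim : finrank ℝ L = finrank ℝ g + 1)
    (hN : (invariantNumber L : ℤ) = (invariantNumber g : ℤ) - 1)
    (hbc : ∀ i : Fin n, b i.castSucc = (c i : L)) (hU : IsOpen U)
    (hF : IsCoadjointInvariantOn b U F) {x : Fin (n + 1) → ℝ} (hx : x ∈ U) :
    partialDeriv F (Fin.last n) x = 0 := by
  obtain ⟨e, he⟩ := exists_line_finrank_range_lt hcodim hN (b.constr ℝ x)
  let γ : ℝ → Fin (n + 1) → ℝ := fun t => x + t • fun i => e (b i)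
  have hγ : Continuous γ := by fun_prop
  have hγ0 : γ 0 = x := by simp [γ]
  have hγU : ∀ᶠ t in nhds 0, γ t ∈ U :=
    hγ.continuousAt.eventually_mem (hU.mem_nhds (by rwa [hγ0]))
  have hzero : ∀ᶠ t in nhdsWithin 0 {0}ᶜ, partialDeriv F (Fin.last n) (γ t) = 0 := by
    filter_upwards [he, nhdsWithin_le_nhds hγU] with t ht htU
    have hconstr : b.constr ℝ x + t • e = b.constr ℝ (γ t) := by
      refine b.ext fun i => ?_
      simp [γ]
    rw [hconstr] at ht
    have hmem := ht _ (commutatorForm_eq_zero_of_fderiv b (γ t) (fderiv ℝ F (γ t))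
      (fun X => hF.fderiv_coadjointField hU htU X))
    have := repr_last_eq_zero hbc hmem
    rwa [b.repr_sum_self] at this
  have hcont : ContinuousAt (fun t => partialDeriv F (Fin.last n) (γ t)) 0 := by
    have h₁ : ContinuousAt (fderiv ℝ F) (γ 0) := by
      rw [hγ0]
      exact (hF.1 x hx).fderiv.continuousAt
    exact (h₁.comp hγ.continuousAt).clm_apply continuousAt_const
  have hlim := hcont.tendsto.mono_left (nhdsWithin_le_nhds (s := {0}ᶜ))
  have := tendsto_nhds_unique hlim (tendsto_const_nhds.congr' (hzero.mono fun t ht => ht.symm))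
  rwa [hγ0] at this

/-- A function on an open set whose last partial derivative vanishes is constant on each fibre of
the projection forgetting the last coordinate, provided that this fibre is connected. -/
lemma eq_of_partialDeriv_last_eq_zero (hd : ∀ x ∈ U, DifferentiableAt ℝ F x)
    (hlast : ∀ x ∈ U, partialDeriv F (Fin.last n) x = 0) {y : Fin n → ℝ}
    (hconn : IsPreconnected {x ∈ U | ∀ i : Fin n, x i.castSucc = y i})
    {x x' : Fin (n + 1) → ℝ} (hx : x ∈ U) (hxy : ∀ i : Fin n, x i.castSucc = y i)
    (hx' : x' ∈ U) (hxy' : ∀ i : Fin n, x' i.castSucc = y i) : F x = F x' := by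
  set S := {x ∈ U | ∀ i : Fin n, x i.castSucc = y i}
  let T : Set ℝ := (fun x : Fin (n + 1) → ℝ => x (Fin.last n)) '' S
  -- The last coordinate maps the fibre onto an interval, and σ inverts it there.
  have hT : Convex ℝ T :=
    (hconn.image _ (continuous_apply _).continuousOn).ordConnected.convex
  let σ : ℝ → Fin (n + 1) → ℝ := Function.update x (Fin.last n)
  have hσ : ∀ z ∈ S, σ (z (Fin.last n)) = z := by
    intro z hz
    ext i
    refine Fin.lastCases ?_ (fun j => ?_) i
    · simp [σ]
    · simp [σ, hxy, hz.2, (Fin.castSucc_lt_last j).ne]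
  have hconst := eq_of_hasDerivAt_zero hT (h := F ∘ σ) (s := x (Fin.last n))
    (t := x' (Fin.last n)) ?_ ⟨x, ⟨hx, hxy⟩, rfl⟩ ⟨x', ⟨hx', hxy'⟩, rfl⟩
  · simpa only [Function.comp_apply, hσ x ⟨hx, hxy⟩, hσ x' ⟨hx', hxy'⟩] using hconst
  · rintro _ ⟨z, hz, rfl⟩
    rw [← hlast z hz.1]
    have hFd : HasFDerivAt F (fderiv ℝ F z) (σ (z (Fin.last n))) := by
      rw [hσ z hz]
      exact (hd z hz.1).hasFDerivAt
    exact hFd.comp_hasDerivAt _ (hasDerivAt_update x (Fin.last n) _)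

theorem IsCoadjointInvariantOn.isInvariantOfSubalgebraOn
    (hbc : ∀ i : Fin n, b i.castSucc = (c i : L)) (hU : IsOpen U)
    (hF : IsCoadjointInvariantOn b U F)
    (hlast : ∀ x ∈ U, partialDeriv F (Fin.last n) x = 0)
    (hconn : ∀ y : Fin n → ℝ, IsPreconnected {x ∈ U | ∀ i : Fin n, x i.castSucc = y i}) :
    IsInvariantOfSubalgebraOn c U F := by
  classical
  let r : (Fin (n + 1) → ℝ) → Fin n → ℝ := fun x i => x i.castSucc
  let Φ : (Fin n → ℝ) → ℝ := fun y =>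
    if h : ∃ x ∈ U, r x = y then F h.choose else 0
  have hΦ : ∀ x ∈ U, F x = Φ (r x) := by
    intro x hx
    have h : ∃ x' ∈ U, r x' = r x := ⟨x, hx, rfl⟩
    simp only [Φ, dif_pos h]
    exact eq_of_partialDeriv_last_eq_zero (fun z hz => (hF.1 z hz).differentiableAt) hlast
      (hconn (r x)) hx (fun _ => rfl) h.choose_spec.1 (congrFun h.choose_spec.2)
  have hanalytic : AnalyticOnNhd ℝ Φ (r '' U) := by
    rintro _ ⟨x, hx, rfl⟩
    -- Freezing the last coordinate gives a local section of r, so Φ = F ∘ σ near r x.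
    let σ : (Fin n → ℝ) → Fin (n + 1) → ℝ := fun y => Fin.snoc y (x (Fin.last n))
    have hσx : σ (r x) = x := Fin.snoc_init_self x
    have hσ : AnalyticAt ℝ σ (r x) := by
      refine analyticAt_pi_iff.2 fun i => ?_
      refine Fin.lastCases ?_ (fun j => ?_) i
      · simpa [σ] using analyticAt_const
      · simp only [Fin.snoc_castSucc]
        exact (ContinuousLinearMap.proj (R := ℝ) (φ := fun _ : Fin n => ℝ) j).analyticAt _
    have hev : ∀ᶠ y in nhds (r x), σ y ∈ U :=
      hσ.continuousAt.eventually_mem (hU.mem_nhds (by rwa [hσx]))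
    have hFσ : AnalyticAt ℝ (F ∘ σ) (r x) :=
      AnalyticAt.comp (by rw [hσx]; exact hF.1 x hx) hσ
    refine hFσ.congr ?_
    filter_upwards [hev] with y hy
    rw [Function.comp_apply, hΦ _ hy]
    congr 1
    ext i
    simp [r, σ]
  refine ⟨Φ, hΦ, isCoadjointInvariantOn_of_fderiv hanalytic ?_⟩
  rintro _ ⟨x, hx, rfl⟩ X
  let ρ : (Fin (n + 1) → ℝ) →L[ℝ] (Fin n → ℝ) :=
    ContinuousLinearMap.pi fun i => ContinuousLinearMap.proj i.castSucc
  have hd : HasFDerivAt (Φ ∘ r) ((fderiv ℝ Φ (r x)).comp ρ) x :=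
    (hanalytic _ ⟨x, hx, rfl⟩).differentiableAt.hasFDerivAt.comp x ρ.hasFDerivAt
  have hFd : HasFDerivAt F ((fderiv ℝ Φ (r x)).comp ρ) x :=
    hd.congr_of_eventuallyEq (Filter.mem_of_superset (hU.mem_nhds hx) hΦ)
  have h := hF.fderiv_coadjointField hU hx (X : L)
  rw [hFd.fderiv] at h
  rw [← h, ContinuousLinearMap.comp_apply]
  congr 1
  ext i
  exact (coadjointField_castSucc hbc X x i).symm

end LastCoordinate

theorem proposition4 {L : Type*} [LieRing L] [LieAlgebra ℝ L] [FiniteDimensional ℝ L]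
    (g : LieSubalgebra ℝ L)
    (hcodim : Module.finrank ℝ L = Module.finrank ℝ g + 1)
    (hN : (invariantNumber L : ℤ) = (invariantNumber g : ℤ) - 1) :
    (∀ (n : ℕ) (c : Module.Basis (Fin n) ℝ g) (b : Module.Basis (Fin (n + 1)) ℝ L),
      (∀ i : Fin n, b i.castSucc = (c i : L)) →
      ∀ (U : Set (Fin (n + 1) → ℝ)) (F : (Fin (n + 1) → ℝ) → ℝ),
        IsOpen U → IsCoadjointInvariantOn b U F →
          (∀ x ∈ U, ∃ V : Set (Fin (n + 1) → ℝ), IsOpen V ∧ x ∈ V ∧ V ⊆ U ∧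
            IsInvariantOfSubalgebraOn c V F) ∧
          ((∀ y : Fin n → ℝ, IsPreconnected {x ∈ U | ∀ i : Fin n, x i.castSucc = y i}) →
            IsInvariantOfSubalgebraOn c U F)) ∧
    (∃ X : L, X ∉ g ∧
      ∀ (n : ℕ) (b : Module.Basis (Fin (n + 1)) ℝ L),
        (∀ i : Fin n, b i.castSucc ∈ g) → b (Fin.last n) = X →
        ∀ (U : Set (Fin (n + 1) → ℝ)) (F : (Fin (n + 1) → ℝ) → ℝ),
          IsOpen U → IsCoadjointInvariantOn b U F →
            ∀ x ∈ U, partialDeriv F (Fin.last n) x = 0) := by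
  constructor
  · intro n c b hbc U F hU hF
    have hlast : ∀ x ∈ U, partialDeriv F (Fin.last n) x = 0 := fun x hx =>
      hF.partialDeriv_last_eq_zero hcodim hN hbc hU hx
    refine ⟨fun x hx => ?_, hF.isInvariantOfSubalgebraOn hbc hU hlast⟩
    obtain ⟨ε, hε, hball⟩ := Metric.isOpen_iff.1 hU x hx
    have hFV : IsCoadjointInvariantOn b (Metric.ball x ε) F :=
      ⟨hF.1.mono hball, fun X z hz harc => hF.2 X z (hball hz) fun t ht => hball (harc t ht)⟩
    refine ⟨Metric.ball x ε, Metric.isOpen_ball, Metric.mem_ball_self hε, hball,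
      hFV.isInvariantOfSubalgebraOn hbc Metric.isOpen_ball (fun z hz => hlast z (hball hz))
        fun y => ?_⟩
    -- Fibres of a ball are convex, being cut out by an affine subspace.
    refine ((convex_ball x ε).inter ?_ : Convex ℝ
      (Metric.ball x ε ∩ {z | ∀ i : Fin n, z i.castSucc = y i})).isPreconnected
    intro z hz w hw s t _ _ hst i
    simp only [Set.mem_ofPred_eq] at hz hw
    simp only [Pi.add_apply, Pi.smul_apply, hz i, hw i, smul_eq_mul, ← add_mul, hst, one_mul]
  · have hne : ∃ X : L, X ∉ g := by
      by_contra! h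
      have htop : g.toSubmodule = ⊤ := Submodule.eq_top_iff'.2 h
      have : finrank ℝ g.toSubmodule = finrank ℝ L := by rw [htop, finrank_top]
      have h' : finrank ℝ g.toSubmodule = finrank ℝ g := rfl
      omega
    obtain ⟨X, hX⟩ := hne
    -- Any X outside g serves.
    refine ⟨X, hX, fun n b hb _ U F hU hF x hx => ?_⟩
    obtain ⟨c, hbc⟩ := exists_basis_castSucc hcodim b hb
    exact hF.partialDeriv_last_eq_zero hcodim hN hbc hU hx
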